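/- Let $k$ be an algebraically closed field of characteristic $0$ and let $X=X_\Sigma$ be the projective toric variety over $k$ of a complete fan $\Sigma$ in $\mathbb{R}^n$ (of strongly convex rational polyhedral cones with respect to $\mathbb{Z}^n$). For each ray $\rho\in\Sigma(1)$ let $D_\rho$ be the corresponding torus-invariant prime divisor, and let $S=k[x_\rho \mid \rho\in\Sigma(1)]$ be the Cox ring of $X$, graded by $\mathrm{Cl}(X)$ through $\deg x_\rho=[D_\rho]$. Let $\alpha\in\mathrm{Cl}(X)$ be a very ample class, that is, $\mathcal{O}_X(\alpha)$ is an invertible sheaf generated by its global sections $H^0(X,\mathcal{O}_X(\alpha))=S_\alpha$, and the morphism to projective space that they define is a closed immersion. Let $x^{\omega^{(0)}},\dots,x^{\omega^{(N)}}$ be the monomials of degree $\alpha$ in some order; they form a basis of $S_\alpha$. Let $A=A_{\Sigma,\alpha}=(\omega^{(0)}\mid\cdots\mid\omega^{(N)})$ be the matrix of their exponents, and let $\varphi_\alpha: X\hookrightarrow\mathbb{P}(S_\alpha^\vee)\cong\mathbb{P}^N$ be the closed immersion given by this basis of sections. Put $k^A=\{\sum_{j} a_j x^{\omega^{(j)}}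 \mid a_j\in k\}=S_\alpha$, and let the $A$-discriminant locus $\nabla_A\subset\mathbb{P}(k^A)$ be the Zariski closure of $$\nabla_A^\circ=\Big\{[f]\in\mathbb{P}(k^A) \;\Big|\; \exists\, x\in(k^*)^{\Sigma(1)}:\ f(x)=0 \text{ and } \frac{\partial f}{\partial x_\rho}(x)=0 \text{ for all } \rho\in\Sigma(1)\Big\}.$$ Let $X^{\vee,\alpha}\subset\mathbb{P}(S_\alpha)$ be the projective dual of $X$ with respect to $\varphi_\alpha$, that is, the Zariski closure of the set of all points $[\sum_j a_jx^{\omega^{(j)}}]$ for which the hyperplane $\sum_j a_jw_j=0$ of $\mathbb{P}^N$ contains the embedded projective tangent space of $\varphi_\alpha(X)$ at some smooth point of $\varphi_\alpha(X)$. Then $$\nabla_A=X^{\vee,\alpha}.$$ -/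

import Mathlib

open scoped LinearAlgebra.Projectivization

universe u

noncomputable section

/-! ## Projective space as a classical variety -/

namespace ProjVar

variable {k : Type u} [Field k] {ι : Type}

/-- The Zariski topology on the projective space `ℙ(k^ι)`: the sets `F ≠ 0`, for `F` homogeneous,
form a basis of open sets. -/
instance zariskiTopology : TopologicalSpace (ℙ k (ι → k)) :=
  TopologicalSpace.generateFrom
    {U | ∃ (d : ℕ) (F : MvPolynomial ι k), F.IsHomogeneous d ∧
      U = {p | MvPolynomial.eval p.rep F ≠ 0}}

/-- The function `h` is regular at `p`: near `p` it is a quotient of two homogeneous polynomials of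
the same degree. -/
def IsRegularAt (p : ℙ k (ι → k)) (h : ℙ k (ι → k) → k) : Prop :=
  ∃ (d : ℕ) (P Q : MvPolynomial ι k), P.IsHomogeneous d ∧ Q.IsHomogeneous d ∧
    MvPolynomial.eval p.rep Q ≠ 0 ∧
    ∀ q : ℙ k (ι → k), MvPolynomial.eval q.rep Q ≠ 0 →
      h q = MvPolynomial.eval q.rep P / MvPolynomial.eval q.rep Q

/-- A point `y` of a Zariski closed subset `Y` of affine space `k^ι` is smooth if some principal
open neighbourhood of `y` in `Y` (with its reduced structure) is smooth over `k`. -/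
def IsSmoothAffinePoint (Y : Set (ι → k)) (y : ι → k) : Prop :=
  ∃ f : MvPolynomial ι k, MvPolynomial.eval y f ≠ 0 ∧
    Algebra.Smooth k
      (Localization.Away (Ideal.Quotient.mk (MvPolynomial.vanishingIdeal k Y) f))

/-- The affine chart `Z ∩ {zᵢ ≠ 0}` of `Z ⊆ ℙ(k^ι)`, inside the affine space `{vᵢ = 1}`. -/
def affineChart (Z : Set (ℙ k (ι → k))) (i : ι) : Set (ι → k) :=
  {v | v i = 1 ∧ ∃ hv : v ≠ 0, Projectivization.mk k v hv ∈ Z}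

/-- `z` is a smooth point of the projective variety `Z`. -/
def IsSmoothPoint (Z : Set (ℙ k (ι → k))) (z : ℙ k (ι → k)) : Prop :=
  z ∈ Z ∧ ∃ i : ι, z.rep i ≠ 0 ∧ IsSmoothAffinePoint (affineChart Z i) ((z.rep i)⁻¹ • z.rep)

variable [Fintype ι]

/-- The linear subspace of `k^ι` whose projectivization is the embedded projective tangent space of
`Z` at `z`. -/
def embeddedTangentSpace (Z : Set (ℙ k (ι → k))) (z : ℙ k (ι → k)) : Set (ι → k) :=
  {w | ∀ (d : ℕ) (F : MvPolynomial ι k), F.IsHomogeneous d →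
    (∀ p ∈ Z, MvPolynomial.eval p.rep F = 0) →
    ∑ j, MvPolynomial.eval z.rep (MvPolynomial.pderiv j F) * w j = 0}

/-- The projective dual of `Z ⊆ ℙ(k^ι)`: the Zariski closure of the set of all hyperplanes
`∑ⱼ aⱼ wⱼ = 0` that contain the embedded tangent space of `Z` at some smooth point of `Z`. The
hyperplane is recorded by its coefficient vector, a point `[a]` of the dual projective space. -/
def projectiveDual (Z : Set (ℙ k (ι → k))) : Set (ℙ k (ι → k)) :=
  closure {a | ∃ z, IsSmoothPoint Z z ∧ ∀ w ∈ embeddedTangentSpace Z z, ∑ j, a.rep j * w j = 0}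

end ProjVar

/-- `φ : X → Y` is a closed immersion of classical varieties (spaces with a notion of `k`-valued
function regular at a point): a homeomorphism onto a closed subset, such that the functions regular
at `x` are locally exactly the pullbacks of the functions regular at `φ x`. -/
def IsClosedImmersionOfVarieties {k : Type u} {X Y : Type*} [TopologicalSpace X]
    [TopologicalSpace Y] (regX : X → (X → k) → Prop) (regY : Y → (Y → k) → Prop)
    (φ : X → Y) : Prop :=
  Topology.IsClosedEmbedding φ ∧
    ∀ (x : X) (g : X → k), regX x g ↔ ∃ h : Y → k, regY (φ x) h ∧ g =ᶠ[nhds x] h ∘ φ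

/-! ## The `A`-discriminant locus -/

namespace ADisc

variable {k : Type u} [Field k] {R ι : Type} [Fintype ι]

/-- The element `∑ⱼ aⱼ x^(ωⱼ)` of `k^A`, where the exponent vectors `ωⱼ = A j` are the columns of
the matrix `A` and the variables `x_ρ` are indexed by `R`. -/
def poly (A : ι → (R →₀ ℕ)) (a : ι → k) : MvPolynomial R k :=
  ∑ j, MvPolynomial.monomial (A j) (a j)

/-- The classes `[f]`, `f ∈ k^A`, such that `f` has a singular point on the torus `(k^*)^R`; a class
is given by the coefficients of `f`. -/
def openLocus (k : Type u) [Field k] (A : ι → (R →₀ ℕ)) : Set (ℙ k (ι → k)) :=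
  {a | ∃ x : R → k, (∀ ρ, x ρ ≠ 0) ∧ MvPolynomial.eval x (poly A a.rep) = 0 ∧
    ∀ ρ, MvPolynomial.eval x (MvPolynomial.pderiv ρ (poly A a.rep)) = 0}

/-- The `A`-discriminant locus. -/
def locus (k : Type u) [Field k] (A : ι → (R →₀ ℕ)) : Set (ℙ k (ι → k)) :=
  closure (openLocus k A)

end ADisc

/-! ## Fans and toric varieties -/

namespace Toric

/-- The inclusion of the lattice `N = ℤⁿ` into `N_ℝ = ℝⁿ`. -/
def toReal {n : ℕ} (v : Fin n → ℤ) : Fin n → ℝ := fun i => (v i : ℝ)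

/-- A (finite) fan of strongly convex rational polyhedral cones in `ℝⁿ`. -/
structure Fan (n : ℕ) where
  cones : Set (PointedCone ℝ (Fin n → ℝ))
  finite : cones.Finite
  nonempty : cones.Nonempty
  rational : ∀ σ ∈ cones, ∃ s : Finset (Fin n → ℤ), σ = PointedCone.hull ℝ (toReal '' (s : Set _))
  stronglyConvex : ∀ σ ∈ cones, ∀ v, v ∈ σ → -v ∈ σ → v = 0
  face_mem : ∀ σ ∈ cones, ∀ τ : PointedCone ℝ (Fin n → ℝ), τ.IsFaceOf σ → τ ∈ cones
  inf_isFaceOf : ∀ σ ∈ cones, ∀ τ ∈ cones, (σ ⊓ τ).IsFaceOf σ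

/-- A lattice vector is primitive if it is not a multiple `d • w` of a lattice vector with
`d ≠ ±1`; in particular it is nonzero. -/
def IsPrimitive {n : ℕ} (v : Fin n → ℤ) : Prop :=
  ∀ (d : ℤ) (w : Fin n → ℤ), v = d • w → IsUnit d

/-- The monoid `S_σ = σ^∨ ∩ M` in the dual lattice `M = ℤⁿ`. -/
def dualMonoid {n : ℕ} (σ : PointedCone ℝ (Fin n → ℝ)) : AddSubmonoid (Fin n → ℤ) where
  carrier := {m | ∀ v ∈ σ, 0 ≤ toReal m ⬝ᵥ v}
  zero_mem' := by
    intro v _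
    simp [toReal, dotProduct]
  add_mem' := by
    intro a b ha hb v hv
    have h : toReal (a + b) = toReal a + toReal b := by
      ext i
      simp [toReal]
    rw [h, add_dotProduct]
    exact add_nonneg (ha v hv) (hb v hv)

theorem dualMonoid_anti {n : ℕ} {τ σ : PointedCone ℝ (Fin n → ℝ)} (h : τ ≤ σ) :
    dualMonoid σ ≤ dualMonoid τ := fun _ hm v hv => hm v (h hv)

/-- The coordinate ring `k[S_σ]` of the affine toric variety `U_σ`. -/
abbrev chartRing (k : Type u) [Field k] {n : ℕ} (σ : PointedCone ℝ (Fin n → ℝ)) : Type u :=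
  AddMonoidAlgebra k (dualMonoid σ)

/-- The character `χ^m` as a regular function on `U_σ`, for `m ∈ S_σ`. -/
def chartChar (k : Type u) [Field k] {n : ℕ} {σ : PointedCone ℝ (Fin n → ℝ)}
    (m : dualMonoid σ) : chartRing k σ := AddMonoidAlgebra.single m 1

/-- The set of `k`-points of `U_σ = Spec k[S_σ]`. -/
def ChartPoint (k : Type u) [Field k] {n : ℕ} (σ : PointedCone ℝ (Fin n → ℝ)) : Type u :=
  chartRing k σ →ₐ[k] k

/-- The value of a regular function on `U_σ` at a point. -/
def ChartPoint.eval {k : Type u} [Field k] {n : ℕ} {σ : PointedCone ℝ (Fin n → ℝ)}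
    (γ : ChartPoint k σ) (f : chartRing k σ) : k :=
  (show chartRing k σ →ₐ[k] k from γ) f

/-- The map `U_τ → U_σ` induced by `τ ⊆ σ`, that is, by `k[S_σ] ⊆ k[S_τ]`. -/
def ChartPoint.incl {k : Type u} [Field k] {n : ℕ} {τ σ : PointedCone ℝ (Fin n → ℝ)}
    (h : τ ≤ σ) (γ : ChartPoint k τ) : ChartPoint k σ :=
  (show chartRing k τ →ₐ[k] k from γ).comp
    (AddMonoidAlgebra.mapDomainAlgHom k k (AddSubmonoid.inclusion (dualMonoid_anti h)))

/-- The Zariski topology on `U_σ`. -/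
instance chartTopology (k : Type u) [Field k] {n : ℕ} (σ : PointedCone ℝ (Fin n → ℝ)) :
    TopologicalSpace (ChartPoint k σ) :=
  TopologicalSpace.generateFrom {U | ∃ f : chartRing k σ, U = {γ | γ.eval f ≠ 0}}

namespace Fan

variable {n : ℕ} (F : Fan n)

/-- The support of the fan is all of `ℝⁿ`; equivalently, the toric variety is complete. -/
def IsComplete : Prop := ∀ v : Fin n → ℝ, ∃ σ ∈ F.cones, v ∈ σ

/-- The one-dimensional cones `Σ(1)` of the fan, each given by its primitive generator `u_ρ`. -/
def Ray : Type :=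
  {u : Fin n → ℤ // IsPrimitive u ∧ PointedCone.hull ℝ {toReal u} ∈ F.cones}

variable {F} in
/-- The primitive generator `u_ρ` of the ray `ρ`. -/
def Ray.gen (ρ : F.Ray) : Fin n → ℤ := ρ.1

/-- The divisor of the character `χ^m`: its coefficient at `D_ρ` is `⟨m, u_ρ⟩`. Torus-invariant
divisors `∑ a_ρ D_ρ` are written as functions `a : Σ(1) → ℤ`. -/
def divChar : (Fin n → ℤ) →+ (F.Ray → ℤ) where
  toFun m := fun ρ => m ⬝ᵥ ρ.gen
  map_zero' := by
    funext ρ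
    simp
  map_add' a b := by
    funext ρ
    simp [add_dotProduct]

/-- The divisor class group `Cl(X)`: torus-invariant divisors modulo divisors of characters. -/
abbrev ClassGroup : Type := (F.Ray → ℤ) ⧸ F.divChar.range

/-- The class of a torus-invariant divisor. -/
def divClass (D : F.Ray → ℤ) : F.ClassGroup := QuotientAddGroup.mk D

/-- The exponents of the monomial basis of the graded piece `S_α` of the Cox ring
`S = k[x_ρ | ρ ∈ Σ(1)]`: the monomials `x^E` (with `E` an effective torus-invariant divisor) of
degree `[E] = α`. -/
def Monomials (α : F.ClassGroup) : Type :=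
  {E : F.Ray →₀ ℕ // F.divClass (fun ρ => (E ρ : ℤ)) = α}

/-- A point of a chart: a cone of the fan and a `k`-point of its affine toric variety. -/
abbrev ChartedPoint (k : Type u) [Field k] : Type u :=
  Σ σ : {σ : PointedCone ℝ (Fin n → ℝ) // σ ∈ F.cones}, ChartPoint k σ.1

/-- The generating gluing relation: a point of `U_τ` is identified with its image in `U_σ` whenever
`τ ⊆ σ` (so that `τ` is a face of `σ`). -/
def Glue (k : Type u) [Field k] (p q : F.ChartedPoint k) : Prop :=
  ∃ h : p.1.1 ≤ q.1.1, q.2 = ChartPoint.incl h p.2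

/-- The (closed points of the) toric variety `X_Σ` over `k`: the affine toric varieties `U_σ`,
glued along the inclusions `U_τ ⊆ U_σ`. -/
def Variety (k : Type u) [Field k] : Type u := Quot (F.Glue k)

/-- The Zariski topology on `X_Σ`: a set is open if its trace on each chart `U_σ` is. -/
instance varietyTopology (k : Type u) [Field k] : TopologicalSpace (F.Variety k) :=
  inferInstanceAs (TopologicalSpace (Quot (F.Glue k)))

variable {F} in
/-- The point of `X_Σ` given by a point of the chart `U_σ`. -/
def point {k : Type u} [Field k] {σ : PointedCone ℝ (Fin n → ℝ)} (hσ : σ ∈ F.cones)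
    (γ : ChartPoint k σ) : F.Variety k := Quot.mk _ ⟨⟨σ, hσ⟩, γ⟩

/-- The function `g` on `X_Σ` is regular at `x`: in some chart `U_σ` around `x` it is, near `x`, a
quotient of two elements of `k[S_σ]`. -/
def IsRegularAt (k : Type u) [Field k] (x : F.Variety k) (g : F.Variety k → k) : Prop :=
  ∃ (σ : PointedCone ℝ (Fin n → ℝ)) (hσ : σ ∈ F.cones) (γ : ChartPoint k σ),
    point hσ γ = x ∧ ∃ P Q : chartRing k σ, γ.eval Q ≠ 0 ∧
      ∀ δ : ChartPoint k σ, δ.eval Q ≠ 0 → g (point hσ δ) = δ.eval P / δ.eval Q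

variable {F} in
/-- `φ : X_Σ → ℙ(k^ι)` is the morphism given by the class `α`, i.e. by the complete linear system
`|α|` with its basis of sections of `O(α)` corresponding to the monomials `x^(Eⱼ)` of degree `α`
(`j ∈ ι`, in the order given by `e`).

On `U_σ` the sheaf `O(α)` has to be trivial: `α` is the class of a divisor `D` with
`D ∩ U_σ = ∅`. With `Eⱼ = D + div(χ^(lⱼ))`, the section `x^(Eⱼ)` is then the regular function
`χ^(lⱼ)` on `U_σ`, these functions have no common zero, and `φ = [χ^(lⱼ)]ⱼ`. -/
def IsMapOfClass {k : Type u} [Field k] {ι : Type} {α : F.ClassGroup} (e : ι ≃ F.Monomials α)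
    (φ : F.Variety k → ℙ k (ι → k)) : Prop :=
  ∀ (σ : PointedCone ℝ (Fin n → ℝ)) (hσ : σ ∈ F.cones) (γ : ChartPoint k σ),
    ∃ D : F.Ray → ℤ, F.divClass D = α ∧ (∀ ρ : F.Ray, toReal ρ.gen ∈ σ → D ρ = 0) ∧
      ∃ l : ι → dualMonoid σ,
        (∀ j, (fun ρ => ((e j).1 ρ : ℤ)) = D + F.divChar (l j : Fin n → ℤ)) ∧
        ∃ hv : (fun j => γ.eval (chartChar k (l j))) ≠ 0,
          φ (point hσ γ) = Projectivization.mk k (fun j => γ.eval (chartChar k (l j))) hv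

variable {F} in
/-- The class `α` is very ample over `k`: `O(α)` is invertible and generated by its global sections,
and the morphism to projective space given by `|α|` is a closed immersion. -/
def IsVeryAmple (k : Type u) [Field k] (α : F.ClassGroup) : Prop :=
  ∃ (N : ℕ) (e : Fin (N + 1) ≃ F.Monomials α) (φ : F.Variety k → ℙ k (Fin (N + 1) → k)),
    IsMapOfClass e φ ∧ IsClosedImmersionOfVarieties (F.IsRegularAt k) ProjVar.IsRegularAt φ

/-- The matrix `A_{Σ,α}`, whose columns are the exponents of the monomial basis of `S_α`. -/
def exponentMatrix {ι : Type} {α : F.ClassGroup} (e : ι ≃ F.Monomials α) : ι → (F.Ray →₀ ℕ) :=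
  fun j => (e j).1

end Fan

end Toric

end

/-! Write t(x) = [x^(ω_j)]_j for x in (k^*)^Σ(1), and Z for the image of φ. All that matters about Z
is that it contains every t(x) and that every form vanishing at all t(x) vanishes on Z
(`IsToricClosure`). This holds because the rays of a complete fan span, so that each k[S_σ] embeds
into the Laurent polynomials in the Cox variables, and these are determined by their values on the
torus.

A hyperplane a tangent at z ∈ Z is the gradient at z of a single form F vanishing on Z
(`exists_eq_gradient`). By Euler's identity and the chain rule, a nonzero gradient of F at t(x) is a
polynomial singular at x. Density of the points t(x) in Z then puts a into the closure ∇_A.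

Conversely, let f = ∑ a_j x^(ω_j) be singular at x. The point z = t(x) is smooth, since inverting
all coordinates turns an affine chart of Z into the group algebra of a lattice. The vector c_j = a_j
x^(ω_j) solves ∑ c_j = 0, Ac = 0. Every integer solution c gives a binomial vanishing on Z, whose
differential forces ∑ c_j w_j / z_j = 0 for tangent vectors w. In characteristic 0 the integer
solutions span all solutions over k, hence ∑ a_j w_j = 0: the hyperplane is tangent even before
taking closures. -/

noncomputable section

/-! ## Extreme rays of polyhedral cones -/

namespace PointedCone

variable {V : Type*} [AddCommGroup V] [Module ℝ V]

/-- Let (a g + z) + (b g + w) = c g with z, w in the hull of `t`. If c > a + b, then g is a positive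
multiple of z + w, which `hg` excludes. Otherwise -z = (a + b - c) g + w lies in the cone, and
strong convexity gives z = 0. -/
theorem isFaceOf_hull_singleton {t : Set V} {g : V} (hg : g ∉ hull ℝ t)
    (hconv : ∀ v, v ∈ hull ℝ (insert g t) → -v ∈ hull ℝ (insert g t) → v = 0) :
    (hull ℝ {g}).IsFaceOf (hull ℝ (insert g t)) := by
  have hle : hull ℝ t ≤ hull ℝ (insert g t) := Submodule.span_mono (Set.subset_insert g t)
  have hgm : g ∈ hull ℝ (insert g t) := Submodule.subset_span (Set.mem_insert g t)
  refine IsFaceOf.of_mem_of_add_mem_left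
    (Submodule.span_mono (Set.singleton_subset_iff.2 (Set.mem_insert g t))) ?_
  intro x y hx hy hxy
  obtain ⟨a, z, hz, rfl⟩ := Submodule.mem_span_insert.1 hx
  obtain ⟨b, w, hw, rfl⟩ := Submodule.mem_span_insert.1 hy
  obtain ⟨c, hc⟩ := Submodule.mem_span_singleton.1 hxy
  change (c : ℝ) • g = (a : ℝ) • g + z + ((b : ℝ) • g + w) at hc
  by_cases h : (a : ℝ) + b < c
  · refine absurd ?_ hg
    have h1 : g = ((c : ℝ) - a - b)⁻¹ • (z + w) := by
      have h2 : z + w = ((c : ℝ) - a - b) • g := by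
        rw [sub_smul, sub_smul, hc]; abel
      rw [h2, smul_smul, inv_mul_cancel₀ (by linarith), one_smul]
    rw [h1]
    exact smul_mem _ (inv_nonneg.2 (by linarith)) (add_mem hz hw)
  · have h2 : -z = ((a : ℝ) + b - c) • g + w := by
      rw [sub_smul, add_smul, hc]; abel
    have hz0 : z = 0 := hconv z (hle hz) (by
      rw [h2]
      exact add_mem (smul_mem _ (by linarith) hgm) (hle hw))
    rw [hz0, add_zero]
    exact Submodule.smul_mem _ _ (Submodule.mem_span_singleton_self g)

/-- A linear form that does not vanish on a strongly convex polyhedral cone does not vanish on one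
of its extreme rays. -/
theorem exists_extreme_ray (s : Finset V)
    (hconv : ∀ v, v ∈ hull ℝ (s : Set V) → -v ∈ hull ℝ (s : Set V) → v = 0)
    (f : V →ₗ[ℝ] ℝ) {v : V} (hv : v ∈ hull ℝ (s : Set V)) (hfv : f v ≠ 0) :
    ∃ g ∈ s, f g ≠ 0 ∧ (hull ℝ {g}).IsFaceOf (hull ℝ (s : Set V)) := by
  classical
  induction s using Finset.strongInduction with
  | H s ih =>
    by_cases hmin : ∃ g ∈ s, g ∈ hull ℝ ((s.erase g : Finset V) : Set V)
    · obtain ⟨g, hgs, hg⟩ := hmin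
      have he : hull ℝ ((s.erase g : Finset V) : Set V) = hull ℝ (s : Set V) := by
        refine le_antisymm (Submodule.span_mono (by simp)) (Submodule.span_le.2 fun x hx => ?_)
        by_cases hxg : x = g
        · exact hxg ▸ hg
        · exact Submodule.subset_span (by simpa [hxg] using hx)
      obtain ⟨x, hx, h1, h2⟩ := ih _ (Finset.erase_ssubset hgs) (by rwa [he]) (by rwa [he])
      exact ⟨x, Finset.mem_of_mem_erase hx, h1, he ▸ h2⟩
    -- With no redundant generator left, every generator spans a face; if `f` vanished on all of
    -- them it would vanish on the cone.
    · push Not at hmin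
      by_contra! hcon
      have hz : ∀ g ∈ s, f g = 0 := by
        intro g hg
        by_contra hfg
        refine hcon g hg hfg ?_
        have hs : (s : Set V) = insert g ((s.erase g : Finset V) : Set V) := by
          rw [← Finset.coe_insert, Finset.insert_erase hg]
        rw [hs] at hconv ⊢
        exact isFaceOf_hull_singleton (hmin g hg) hconv
      refine hfv ?_
      have hle : hull ℝ (s : Set V) ≤ ofSubmodule (LinearMap.ker f) :=
        Submodule.span_le.2 fun x hx => hz x hx
      exact hle hv

end PointedCone

namespace Toric

/-! ## Primitive lattice vectors -/

variable {n : ℕ}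

theorem IsPrimitive.gcd_eq_one {u : Fin n → ℤ} (hu : IsPrimitive u) : Finset.univ.gcd u = 1 := by
  have h : ∀ i, Finset.univ.gcd u ∣ u i := fun i => Finset.gcd_dvd (Finset.mem_univ i)
  choose w hw using h
  have := hu (Finset.univ.gcd u) w (by ext i; simpa using hw i)
  rw [← Finset.normalize_gcd]
  exact normalize_eq_one.2 this

theorem exists_isPrimitive {g : Fin n → ℤ} (hg : g ≠ 0) :
    ∃ (u : Fin n → ℤ) (d : ℤ), IsPrimitive u ∧ 0 < d ∧ g = d • u := by
  have h : ∀ i, Finset.univ.gcd g ∣ g i := fun i => Finset.gcd_dvd (Finset.mem_univ i)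
  choose u hu using h
  have hd : Finset.univ.gcd g ≠ 0 := by
    intro h0
    exact hg (funext fun i => Finset.gcd_eq_zero_iff.1 h0 i (Finset.mem_univ i))
  refine ⟨u, Finset.univ.gcd g, ?_, ?_, by ext i; simpa using hu i⟩
  · intro e w hw
    have h1 : Finset.univ.gcd g * e ∣ Finset.univ.gcd g := by
      refine Finset.dvd_gcd fun i _ => ⟨w i, ?_⟩
      rw [mul_assoc]
      conv_lhs => rw [hu i, hw]
      simp
    obtain ⟨c, hc⟩ := h1
    refine IsUnit.of_mul_eq_one c (mul_left_cancel₀ hd ?_)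
    rw [mul_one, ← mul_assoc]
    exact hc.symm
  · refine lt_of_le_of_ne ?_ hd.symm
    exact Int.nonneg_of_normalize_eq_self Finset.normalize_gcd

/-- Proportionality gives the integer identity u_j v = v_j u. Taking gcds of both sides yields |u_j|
= |v_j|, and c ≥ 0 excludes opposite signs. -/
theorem IsPrimitive.eq_of_smul {u v : Fin n → ℤ} (hu : IsPrimitive u) (hv : IsPrimitive v)
    {c : ℝ} (hc : 0 ≤ c) (h : toReal u = c • toReal v) : u = v := by
  have hi : ∀ i, (u i : ℝ) = c * v i := fun i => congrFun h i
  have habs : ∀ j, normalize (u j) = normalize (v j) := by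
    intro j
    have h1 := Finset.gcd_mul_left (s := Finset.univ) (f := v) (a := u j)
    have h2 := Finset.gcd_mul_left (s := Finset.univ) (f := u) (a := v j)
    rw [hv.gcd_eq_one, mul_one] at h1
    rw [hu.gcd_eq_one, mul_one] at h2
    rw [← h1, ← h2]
    congr 1
    ext i
    have : (u j : ℝ) * v i = v j * u i := by rw [hi i, hi j]; ring
    exact_mod_cast this
  ext j
  rcases Int.associated_iff.1 (normalize_eq_normalize_iff_associated.1 (habs j)) with h1 | h1
  · exact h1
  · have h2 := hi j
    rw [h1] at h2 ⊢
    push_cast at h2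
    have h3 : (v j : ℝ) = 0 := by
      have : (1 + c) * (v j : ℝ) = 0 := by linarith
      rcases mul_eq_zero.1 this with h4 | h4
      · linarith
      · exact h4
    have : v j = 0 := by exact_mod_cast h3
    simp [this]

namespace Fan

variable (F : Fan n)

instance finite_ray : Finite F.Ray := by
  have : Finite F.cones := F.finite
  refine Finite.of_injective
    (fun ρ : F.Ray => (⟨_, ρ.2.2⟩ : F.cones)) fun ρ ρ' h => Subtype.ext ?_
  have h1 : PointedCone.hull ℝ {toReal ρ.1} = PointedCone.hull ℝ {toReal ρ'.1} :=
    congrArg Subtype.val h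
  have h2 : toReal ρ.1 ∈ PointedCone.hull ℝ {toReal ρ'.1} :=
    h1 ▸ Submodule.mem_span_singleton_self _
  obtain ⟨c, hc⟩ := Submodule.mem_span_singleton.1 h2
  exact ρ.2.1.eq_of_smul ρ'.2.1 c.2 hc.symm

/-- By strong convexity {0} is a face of any cone; its chart is the big torus. -/
theorem bot_mem_cones : (⊥ : PointedCone ℝ (Fin n → ℝ)) ∈ F.cones := by
  obtain ⟨σ, hσ⟩ := F.nonempty
  refine F.face_mem σ hσ ⊥ (PointedCone.IsFaceOf.of_mem_of_add_mem_left bot_le ?_)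
  intro x y hx hy hxy
  rw [Submodule.mem_bot] at hxy ⊢
  exact F.stronglyConvex σ hσ x hx (by rwa [neg_eq_of_add_eq_zero_right hxy])

variable {F}

/-- The rays of a complete fan span: only the trivial character has divisor zero. -/
theorem IsComplete.divChar_injective (hF : F.IsComplete) : Function.Injective F.divChar := by
  classical
  rw [injective_iff_map_eq_zero]
  intro m hm
  by_contra hm0
  -- Completeness is applied to the vector `m` itself: the form `m` is nonzero there, hence nonzero
  -- on an extreme ray of the cone containing it.
  have hself : toReal m ⬝ᵥ toReal m ≠ 0 := by
    intro h
    refine hm0 (funext fun i => ?_)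
    have := congrFun (dotProduct_self_eq_zero.1 h) i
    simpa [toReal] using this
  obtain ⟨σ, hσ, hv⟩ := hF (toReal m)
  obtain ⟨s, rfl⟩ := F.rational σ hσ
  have hs : toReal '' (s : Set (Fin n → ℤ)) = ((s.image toReal : Finset _) : Set _) := by simp
  have hsc := F.stronglyConvex _ hσ
  rw [hs] at hv hσ hsc
  obtain ⟨g, hg, hfg, hface⟩ := PointedCone.exists_extreme_ray (s.image toReal)
    hsc (dotProductBilin ℝ ℝ (toReal m)) hv hself
  obtain ⟨g, -, rfl⟩ := Finset.mem_image.1 hg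
  have hg0 : g ≠ 0 := by
    rintro rfl
    exact hfg (by simp [toReal, dotProduct])
  obtain ⟨u, d, hu, hd, rfl⟩ := exists_isPrimitive hg0
  have hd' : (0 : ℝ) < d := by exact_mod_cast hd
  have hdu : toReal (d • u) = (d : ℝ) • toReal u := by ext i; simp [toReal]
  have hcone : PointedCone.hull ℝ {toReal (d • u)} = PointedCone.hull ℝ {toReal u} := by
    refine le_antisymm (Submodule.span_le.2 ?_) (Submodule.span_le.2 ?_)
    · rw [Set.singleton_subset_iff, hdu]
      exact PointedCone.smul_mem _ hd'.le (Submodule.mem_span_singleton_self _)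
    · rw [Set.singleton_subset_iff]
      have : toReal u = (d : ℝ)⁻¹ • toReal (d • u) := by
        rw [hdu, smul_smul, inv_mul_cancel₀ hd'.ne', one_smul]
      rw [this]
      exact PointedCone.smul_mem _ (inv_nonneg.2 hd'.le) (Submodule.mem_span_singleton_self _)
  have hray := F.face_mem _ hσ _ hface
  rw [hcone] at hray
  have h0 : m ⬝ᵥ u = 0 := congrFun hm (⟨u, hu, hray⟩ : F.Ray)
  refine hfg ?_
  have h1 : toReal m ⬝ᵥ toReal u = ((m ⬝ᵥ u : ℤ) : ℝ) := by simp [toReal, dotProduct]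
  change toReal m ⬝ᵥ toReal (d • u) = 0
  rw [hdu, dotProduct_smul, h1, h0]
  simp

end Fan

end Toric

/-! ## Smoothness of the group algebra of a lattice -/

section GroupAlgebra

/-- Algebra maps R[L] → B are group homomorphisms L → Bˣ. Since `I` is nilpotent, Bˣ → (B/I)ˣ is
surjective, and projectivity of L lifts the homomorphism. -/
theorem AddMonoidAlgebra.formallySmooth_of_projective (R : Type*) [CommRing R]
    (L : Type*) [AddCommGroup L] [Module.Projective ℤ L] :
    Algebra.FormallySmooth R (AddMonoidAlgebra R L) := by
  refine Algebra.FormallySmooth.of_comp_surjective fun B _ _ I hI g => ?_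
  have hnil : IsNilpotent I := ⟨2, hI⟩
  let π : Additive Bˣ →ₗ[ℤ] Additive (B ⧸ I)ˣ :=
    (MonoidHom.toAdditive (Units.map (Ideal.Quotient.mk I : B →* B ⧸ I))).toIntLinearMap
  let u : L →ₗ[ℤ] Additive (B ⧸ I)ˣ := AddMonoidHom.toIntLinearMap
    (MonoidHom.toAdditiveRight ((AddMonoidAlgebra.lift R (B ⧸ I) L).symm g).toHomUnits)
  have hπ : Function.Surjective π := by
    intro w
    obtain ⟨b, hb⟩ := Ideal.Quotient.mk_surjective (Additive.toMul w : (B ⧸ I)ˣ).1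
    have hbu : IsUnit b := (hnil.isUnit_quotient_mk_iff).1 (hb ▸ Units.isUnit _)
    refine ⟨Additive.ofMul hbu.unit, ?_⟩
    apply Additive.toMul.injective
    exact Units.ext hb
  obtain ⟨h, hh⟩ := Module.projective_lifting_property π u hπ
  refine ⟨AddMonoidAlgebra.lift R B L
    ((Units.coeHom B).comp (AddMonoidHom.toMultiplicativeLeft h.toAddMonoidHom)), ?_⟩
  refine AddMonoidAlgebra.algHom_ext (fun l => ?_) (by ext)
  have h1 := congrArg (fun w : Additive (B ⧸ I)ˣ => (Additive.toMul w : (B ⧸ I)ˣ).1)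
    (LinearMap.congr_fun hh l)
  simp only [AlgHom.coe_comp, Function.comp_apply, lift_single, one_smul]
  exact h1

theorem AddMonoidAlgebra.smooth_of_lattice (k : Type*) [Field k] {M : Type*} [Finite M]
    (L : Submodule ℤ (M → ℤ)) : Algebra.Smooth k (AddMonoidAlgebra k L) := by
  have : AddMonoid.FG L := AddGroup.fg_iff_addMonoid_fg.1
    ((Module.Finite.iff_addGroup_fg (G := L)).1 inferInstance)
  exact ⟨AddMonoidAlgebra.formallySmooth_of_projective k L,
    Algebra.FinitePresentation.of_finiteType.1 inferInstance⟩

end GroupAlgebra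

/-! ## Homogeneous polynomials -/

namespace MvPolynomial

variable {k : Type*} [Field k] {ι : Type*}

theorem IsHomogeneous.aeval_smul {S : Type*} [CommSemiring S] [Algebra k S] {d : ℕ}
    {F : MvPolynomial ι k} (hF : F.IsHomogeneous d) (c : S) (v : ι → S) :
    MvPolynomial.aeval (fun i => c * v i) F = c ^ d * MvPolynomial.aeval v F := by
  rw [aeval_def, aeval_def, eval₂_eq, eval₂_eq, Finset.mul_sum]
  refine Finset.sum_congr rfl fun m hm => ?_
  have hd := hF (mem_support_iff.1 hm)
  rw [Finsupp.weight_apply, Finsupp.sum] at hd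
  simp only [Pi.one_apply, smul_eq_mul, mul_one] at hd
  simp only [mul_pow, Finset.prod_mul_distrib, Finset.prod_pow_eq_pow_sum, hd]
  ring

theorem IsHomogeneous.eval_smul {d : ℕ} {F : MvPolynomial ι k} (hF : F.IsHomogeneous d) (c : k)
    (v : ι → k) : eval (c • v) F = c ^ d * eval v F :=
  hF.aeval_smul c v

/-- The homogenization of `f` with respect to the variable `i`. -/
def homogenizeAt (i : ι) (f : MvPolynomial ι k) : MvPolynomial ι k :=
  ∑ e ∈ Finset.range (f.totalDegree + 1), X i ^ (f.totalDegree - e) * homogeneousComponent e f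

theorem homogenizeAt_isHomogeneous (i : ι) (f : MvPolynomial ι k) :
    (homogenizeAt i f).IsHomogeneous f.totalDegree := by
  refine IsHomogeneous.sum _ _ _ fun e he => ?_
  have := (isHomogeneous_X_pow (R := k) i (f.totalDegree - e)).mul
    (homogeneousComponent_isHomogeneous e f)
  rwa [Nat.sub_add_cancel (Nat.lt_succ_iff.1 (Finset.mem_range.1 he))] at this

theorem eval_homogenizeAt {i : ι} (f : MvPolynomial ι k) {v : ι → k} (hv : v i = 1) :
    eval v (homogenizeAt i f) = eval v f := by
  conv_rhs => rw [← sum_homogeneousComponent f]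
  simp [homogenizeAt, hv]

theorem pderiv_aeval [Fintype ι] {R : Type*} (g : ι → MvPolynomial R k) (ρ : R)
    (F : MvPolynomial ι k) :
    pderiv ρ (aeval g F) = ∑ j, aeval g (pderiv j F) * pderiv ρ (g j) := by
  classical
  induction F using MvPolynomial.induction_on with
  | C a => simp
  | add p q hp hq => simp only [map_add, hp, hq, add_mul, Finset.sum_add_distrib]
  | mul_X p i hp =>
    simp only [map_mul, aeval_X, Derivation.leibniz, hp, smul_eq_mul, map_add, add_mul,
      Finset.sum_add_distrib, pderiv_X, Finset.mul_sum]
    congr 1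
    · rw [Finset.sum_eq_single i]
      · simp
      · intro j _ hj
        simp [hj]
      · simp
    · exact Finset.sum_congr rfl fun j _ => by ring

theorem IsHomogeneous.sum_mul_eval_pderiv [Fintype ι] {d : ℕ} {F : MvPolynomial ι k}
    (hF : F.IsHomogeneous d) (v : ι → k) :
    ∑ j, eval v (pderiv j F) * v j = d * eval v F := by
  have := congrArg (eval v) hF.sum_X_mul_pderiv
  simpa [mul_comm] using this

end MvPolynomial

/-! ## Zariski topology and tangent hyperplanes in projective space -/

namespace ProjVar

open MvPolynomial

variable {k : Type u} [Field k] {ι : Type}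

theorem rep_mk (v : ι → k) (hv : v ≠ 0) :
    ∃ c : k, c ≠ 0 ∧ (Projectivization.mk k v hv).rep = c • v := by
  obtain ⟨a, ha⟩ := Projectivization.exists_smul_eq_mk_rep k v hv
  exact ⟨a, a.ne_zero, ha.symm⟩

theorem eval_rep_mk_eq_zero_iff {d : ℕ} {F : MvPolynomial ι k} (hF : F.IsHomogeneous d)
    (v : ι → k) (hv : v ≠ 0) :
    eval (Projectivization.mk k v hv).rep F = 0 ↔ eval v F = 0 := by
  obtain ⟨c, hc, h⟩ := rep_mk v hv
  rw [h, hF.eval_smul, mul_eq_zero, or_iff_right (pow_ne_zero _ hc)]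

theorem isTopologicalBasis_zariski :
    TopologicalSpace.IsTopologicalBasis {U : Set (ℙ k (ι → k)) |
      ∃ (d : ℕ) (F : MvPolynomial ι k), F.IsHomogeneous d ∧ U = {p | eval p.rep F ≠ 0}} := by
  refine ⟨?_, ?_, rfl⟩
  · rintro _ ⟨d, F, hF, rfl⟩ _ ⟨e, G, hG, rfl⟩ p ⟨h1, h2⟩
    refine ⟨_, ⟨d + e, F * G, hF.mul hG, rfl⟩, ?_, ?_⟩
    · simpa using ⟨h1, h2⟩
    · intro q hq
      simpa using hq
  · refine Set.eq_univ_of_forall fun p => ?_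
    exact ⟨_, ⟨0, 1, isHomogeneous_one _ _, rfl⟩, by simp⟩

theorem mem_closure_iff {S : Set (ℙ k (ι → k))} {a : ℙ k (ι → k)} :
    a ∈ closure S ↔ ∀ (d : ℕ) (F : MvPolynomial ι k), F.IsHomogeneous d → eval a.rep F ≠ 0 →
      ∃ p ∈ S, eval p.rep F ≠ 0 := by
  rw [isTopologicalBasis_zariski.mem_closure_iff]
  constructor
  · intro h d F hF ha
    obtain ⟨p, hp, hpS⟩ := h _ ⟨d, F, hF, rfl⟩ ha
    exact ⟨p, hpS, hp⟩
  · rintro h _ ⟨d, F, hF, rfl⟩ ha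
    obtain ⟨p, hpS, hp⟩ := h d F hF ha
    exact ⟨p, hp, hpS⟩

variable [Fintype ι]

/-- The gradients at `z` of the homogeneous polynomials that vanish on `Z`. -/
def conormalSpace (Z : Set (ℙ k (ι → k))) {z : ℙ k (ι → k)} (hz : z ∈ Z) :
    Submodule k (ι → k) where
  carrier := {b | ∃ (d : ℕ) (F : MvPolynomial ι k), F.IsHomogeneous d ∧
    (∀ p ∈ Z, eval p.rep F = 0) ∧ b = fun j => eval z.rep (pderiv j F)}
  zero_mem' := ⟨0, 0, isHomogeneous_zero _ _ _, by simp, by ext; simp⟩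
  add_mem' := by
    rintro _ _ ⟨d, F, hF, hFZ, rfl⟩ ⟨e, G, hG, hGZ, rfl⟩
    obtain ⟨i, hi⟩ := Function.ne_iff.1 z.rep_nonzero
    rw [Pi.zero_apply] at hi
    -- Powers of a coordinate nonzero at `z` equalize the degrees; as F and G vanish at `z`, the
    -- extra terms of the product rule disappear there.
    refine ⟨d + e, C ((z.rep i)⁻¹ ^ e) * (X i ^ e * F) + C ((z.rep i)⁻¹ ^ d) * (X i ^ d * G),
      ?_, ?_, ?_⟩
    · refine IsHomogeneous.add (IsHomogeneous.C_mul ?_ _) (IsHomogeneous.C_mul ?_ _)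
      · rw [add_comm]
        exact (isHomogeneous_X_pow i e).mul hF
      · exact (isHomogeneous_X_pow i d).mul hG
    · intro p hp
      simp [hFZ p hp, hGZ p hp]
    · ext j
      simp [hFZ z hz, hGZ z hz, Derivation.leibniz, hi]
  smul_mem' := by
    rintro c _ ⟨d, F, hF, hFZ, rfl⟩
    exact ⟨d, C c * F, hF.C_mul c, fun p hp => by simp [hFZ p hp], by ext; simp⟩

/-- A hyperplane containing the embedded tangent space at `z` is the gradient at `z` of a single
equation. -/
theorem exists_eq_gradient {Z : Set (ℙ k (ι → k))} {z : ℙ k (ι → k)} (hz : z ∈ Z) {a : ι → k}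
    (ha : ∀ w ∈ embeddedTangentSpace Z z, ∑ j, a j * w j = 0) :
    ∃ (d : ℕ) (F : MvPolynomial ι k), F.IsHomogeneous d ∧
      (∀ p ∈ Z, eval p.rep F = 0) ∧ a = fun j => eval z.rep (pderiv j F) := by
  classical
  change a ∈ conormalSpace Z hz
  by_contra hcon
  -- A linear form `f` that kills the conormal space but not `a` is pairing with the vector
  -- (f(e_j))_j, which is therefore a tangent vector.
  obtain ⟨f, hfa, hf⟩ := Submodule.exists_le_ker_of_notMem hcon
  have hfs : ∀ b : ι → k, f b = ∑ j, b j * f (Pi.single j 1) := by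
    intro b
    conv_lhs => rw [pi_eq_sum_univ' b]
    simp
  refine hfa ?_
  rw [hfs]
  refine ha _ fun d F hF hFZ => ?_
  rw [← hfs]
  exact hf ⟨d, F, hF, hFZ, rfl⟩

end ProjVar

/-! ## Laurent monomials on the torus -/

section Torus

open MvPolynomial

variable {k : Type u} [Field k] {R ι : Type} [Fintype R]

/-- The value at the torus point `x` of the Laurent monomial with exponent `E`. -/
def laurentMonomial (x : R → kˣ) (E : R → ℤ) : kˣ := ∏ ρ, x ρ ^ E ρ

theorem laurentMonomial_zero (x : R → kˣ) : laurentMonomial x 0 = 1 := by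
  simp [laurentMonomial]

theorem laurentMonomial_add (x : R → kˣ) (E E' : R → ℤ) :
    laurentMonomial x (E + E') = laurentMonomial x E * laurentMonomial x E' := by
  simp [laurentMonomial, zpow_add, Finset.prod_mul_distrib]

theorem laurentMonomial_sub (x : R → kˣ) (E E' : R → ℤ) :
    laurentMonomial x (E - E') = laurentMonomial x E * (laurentMonomial x E')⁻¹ := by
  simp [laurentMonomial, zpow_sub, Finset.prod_mul_distrib]

/-- The evaluation of Laurent polynomials at the torus point `x`. -/
def torusEval (x : R → kˣ) : AddMonoidAlgebra k (R → ℤ) →ₐ[k] k :=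
  AddMonoidAlgebra.lift k k (R → ℤ)
    { toFun := fun E => (laurentMonomial x E.toAdd : k)
      map_one' := by simp [laurentMonomial_zero]
      map_mul' := fun E E' => by simp [laurentMonomial_add] }

theorem torusEval_single (x : R → kˣ) (E : R → ℤ) (c : k) :
    torusEval x (AddMonoidAlgebra.single E c) = c * laurentMonomial x E := by
  simp [torusEval, AddMonoidAlgebra.lift_single]

/-- The Laurent monomial with exponent `E`, as a character of the torus. -/
def laurentHom (k : Type u) [Field k] (E : R → ℤ) : (R → kˣ) →* k where
  toFun x := laurentMonomial x E
  map_one' := by simp [laurentMonomial]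
  map_mul' x y := by simp [laurentMonomial, mul_zpow, Finset.prod_mul_distrib]

/-- The exponent at ρ is read off at the point with coordinate 2 at ρ and 1 elsewhere, as 2 has
infinite order in characteristic 0. -/
theorem laurentHom_injective [CharZero k] :
    Function.Injective (laurentHom k : (R → ℤ) → ((R → kˣ) →* k)) := by
  classical
  intro E E' h
  ext ρ
  have h2 : (2 : k) ≠ 0 := two_ne_zero
  have hv : ∀ E : R → ℤ, laurentHom k E (Pi.mulSingle ρ (Units.mk0 2 h2)) = 2 ^ E ρ := by
    intro E
    simp only [laurentHom, laurentMonomial, MonoidHom.coe_mk, OneHom.coe_mk]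
    rw [Finset.prod_eq_single ρ]
    · simp
    · intro ρ' _ hne
      simp [Pi.mulSingle_eq_of_ne hne]
    · simp
  have h3 : (2 : k) ^ E ρ = 2 ^ E' ρ := by rw [← hv, ← hv, h]
  have h4 : (((2 : ℚ) ^ E ρ : ℚ) : k) = ((2 : ℚ) ^ E' ρ : ℚ) := by push_cast; exact h3
  exact zpow_right_injective₀ (by norm_num) (by norm_num) (Rat.cast_injective h4)

/-- Distinct Laurent monomials are distinct characters of the torus, so they are linearly
independent by Dedekind. -/
theorem eq_zero_of_torusEval [CharZero k] {f : AddMonoidAlgebra k (R → ℤ)}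
    (h : ∀ x, torusEval x f = 0) : f = 0 := by
  have hli : LinearIndependent k (fun E : R → ℤ => (laurentHom k E : (R → kˣ) → k)) :=
    (linearIndependent_monoidHom (R → kˣ) k).comp (laurentHom k) laurentHom_injective
  have h0 := linearIndependent_iff.1 hli f.coeff (by
    ext x
    have hx := h x
    rw [torusEval, AddMonoidAlgebra.lift_apply] at hx
    rw [Finsupp.linearCombination_apply, Finsupp.sum, Finset.sum_apply]
    exact hx)
  ext E
  simp [h0]

/-- The monomials with exponents `A j`, evaluated at the torus point `x`. -/
def monomialVector (A : ι → (R →₀ ℕ)) (x : R → kˣ) : ι → k :=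
  fun j => laurentMonomial x (fun ρ => (A j ρ : ℤ))

theorem monomialVector_apply_ne_zero (A : ι → (R →₀ ℕ)) (x : R → kˣ) (j : ι) :
    monomialVector A x j ≠ 0 := Units.ne_zero _

theorem monomialVector_ne_zero [Nonempty ι] (A : ι → (R →₀ ℕ)) (x : R → kˣ) :
    monomialVector A x ≠ 0 := fun h =>
  monomialVector_apply_ne_zero A x (Classical.arbitrary ι) (congrFun h _)

theorem eval_monomial_units (A : ι → (R →₀ ℕ)) (x : R → kˣ) (j : ι) (c : k) :
    eval (fun ρ => (x ρ : k)) (monomial (A j) c) = c * monomialVector A x j := by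
  rw [eval_monomial, Finsupp.prod_fintype _ _ (by simp)]
  simp [monomialVector, laurentMonomial]

/-- If `F` vanishes along the monomial parametrization, so do its derivatives along it. -/
theorem sum_pderiv_mul_pderiv_monomial [Infinite k] [Fintype ι] (A : ι → (R →₀ ℕ))
    {F : MvPolynomial ι k} (hF : ∀ x : R → kˣ, eval (monomialVector A x) F = 0)
    (x : R → kˣ) (ρ : R) :
    ∑ j, eval (monomialVector A x) (pderiv j F) *
      eval (fun ρ => (x ρ : k)) (pderiv ρ (monomial (A j) 1)) = 0 := by
  have hev : ∀ (y : R → kˣ) (G : MvPolynomial ι k),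
      eval (fun ρ => (y ρ : k)) (aeval (fun j => monomial (A j) (1 : k)) G) =
        eval (monomialVector A y) G := by
    intro y G
    have := MvPolynomial.map_aeval (fun j => monomial (A j) (1 : k))
      (eval (fun ρ => (y ρ : k))) G
    rw [this]
    simp only [eval_monomial_units, one_mul, algebraMap_eq]
    rw [show (eval fun ρ => (y ρ : k)).comp C = RingHom.id k from RingHom.ext fun a => by simp]
    rfl
  have h0 : aeval (fun j => monomial (A j) (1 : k)) F = 0 := by
    -- The factor ∏ X_ρ extends the vanishing from the torus to all of k^R, where `k` infinite makes
    -- the polynomial zero.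
    have hmul : aeval (fun j => monomial (A j) (1 : k)) F * ∏ ρ, X ρ = 0 := by
      refine MvPolynomial.funext fun y => ?_
      by_cases hy : ∀ ρ, y ρ ≠ 0
      · have := hev (fun ρ => Units.mk0 (y ρ) (hy ρ)) F
        simp only [Units.val_mk0] at this
        rw [map_mul, this, hF, zero_mul, map_zero]
      · push Not at hy
        obtain ⟨ρ, hρ⟩ := hy
        rw [map_mul, map_prod, Finset.prod_eq_zero (Finset.mem_univ ρ) (by simpa using hρ),
          mul_zero, map_zero]
    refine (mul_eq_zero.1 hmul).resolve_right ?_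
    exact Finset.prod_ne_zero_iff.2 fun ρ _ => X_ne_zero ρ
  have h1 := congrArg (eval fun ρ => (x ρ : k)) (pderiv_aeval (fun j => monomial (A j) (1 : k)) ρ F)
  rw [h0, map_zero, map_zero, map_sum] at h1
  simp only [map_mul, hev] at h1
  exact h1.symm

end Torus

/-! ## Linear relations with integer coefficients -/

/-- A linear form that vanishes on the integer solutions of a homogeneous linear system with integer
coefficients vanishes on all solutions over a field of characteristic zero. -/
theorem sum_mul_eq_zero_of_int_solutions {k : Type*} [Field k] [CharZero k] {κ ι : Type*}
    [Fintype ι] (B : κ → ι → ℤ) (h : ι → k)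
    (hint : ∀ c : ι → ℤ, (∀ i, ∑ j, B i j * c j = 0) → ∑ j, (c j : k) * h j = 0)
    (c : ι → k) (hc : ∀ i, ∑ j, (B i j : k) * c j = 0) : ∑ j, c j * h j = 0 := by
  have hrat : ∀ q : ι → ℚ, (∀ i, ∑ j, (B i j : ℚ) * q j = 0) → ∑ j, (q j : k) * h j = 0 := by
    intro q hq
    obtain ⟨b, hb⟩ := IsLocalization.exist_integer_multiples_of_finite (nonZeroDivisors ℤ) q
    choose z hz using hb
    have hb0 : ((b : ℤ) : ℚ) ≠ 0 := by exact_mod_cast nonZeroDivisors.ne_zero b.2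
    have hz' : ∀ j, (z j : ℚ) = (b : ℤ) * q j := fun j => by
      simpa [Algebra.smul_def] using hz j
    have h1 := hint z fun i => by
      have : (∑ j, (B i j : ℚ) * z j) = (b : ℤ) * ∑ j, (B i j : ℚ) * q j := by
        rw [Finset.mul_sum]
        exact Finset.sum_congr rfl fun j _ => by rw [hz' j]; ring
      rw [hq i, mul_zero] at this
      exact_mod_cast this
    have h2 : ∑ j, (z j : k) * h j = ((b : ℤ) : k) * ∑ j, (q j : k) * h j := by
      rw [Finset.mul_sum]
      refine Finset.sum_congr rfl fun j _ => ?_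
      have : (z j : k) = ((b : ℤ) : k) * (q j : k) := by
        exact_mod_cast congrArg (Rat.cast (K := k)) (hz' j)
      rw [this, mul_assoc]
    rw [h1] at h2
    refine (mul_eq_zero.1 h2.symm).resolve_left ?_
    exact_mod_cast nonZeroDivisors.ne_zero b.2
  -- Since `B` is integral, the coordinates of a solution in a ℚ-basis of `k` are rational
  -- solutions, which `hrat` handles.
  let b := Module.Free.chooseBasis ℚ k
  have hcoord : ∀ t, ∑ j, ((b.coord t (c j) : ℚ) : k) * h j = 0 := by
    intro t
    refine hrat _ fun i => ?_
    have h1 := congrArg (b.coord t) (hc i)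
    rw [map_zero, map_sum] at h1
    rw [← h1]
    refine Finset.sum_congr rfl fun j _ => ?_
    have : ((B i j : ℤ) : k) * c j = ((B i j : ℤ) : ℚ) • c j := by
      simp [Algebra.smul_def]
    rw [this, map_smul, smul_eq_mul]
  classical
  let s : Finset (Module.Free.ChooseBasisIndex ℚ k) :=
    Finset.univ.biUnion fun j => (b.repr (c j)).support
  have hexp : ∀ j, c j = ∑ t ∈ s, ((b.coord t (c j) : ℚ) : k) * b t := by
    intro j
    conv_lhs => rw [← b.linearCombination_repr (c j), Finsupp.linearCombination_apply]
    rw [Finsupp.sum_of_support_subset (s := s)]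
    · exact Finset.sum_congr rfl fun t _ => by simp [Algebra.smul_def]
    · exact Finset.subset_biUnion_of_mem (fun j => (b.repr (c j)).support) (Finset.mem_univ j)
    · simp
  calc ∑ j, c j * h j = ∑ j, ∑ t ∈ s, b t * (((b.coord t (c j) : ℚ) : k) * h j) := by
        refine Finset.sum_congr rfl fun j _ => ?_
        conv_lhs => rw [hexp j, Finset.sum_mul]
        exact Finset.sum_congr rfl fun t _ => by ring
    _ = ∑ t ∈ s, b t * ∑ j, ((b.coord t (c j) : ℚ) : k) * h j := by
        rw [Finset.sum_comm]
        simp only [Finset.mul_sum]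
    _ = 0 := Finset.sum_eq_zero fun t _ => by rw [hcoord t, mul_zero]

/-! ## Smoothness of the torus in a projective toric variety -/

/-- The hypotheses make `B` the localization of `A` at `r`. -/
theorem Algebra.smooth_localizationAway {k A B : Type*} [Field k] [CommRing A] [CommRing B]
    [Algebra k A] [Algebra k B] [Algebra.Smooth k B] (ψ : A →ₐ[k] B) (r : A)
    (hinj : Function.Injective ψ) (hunit : IsUnit (ψ r))
    (hsurj : ∀ b, ∃ (n : ℕ) (a : A), b * ψ r ^ n = ψ a) :
    Algebra.Smooth k (Localization.Away r) := by
  let _ : Algebra A B := ψ.toRingHom.toAlgebra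
  have : IsScalarTower k A B := IsScalarTower.of_algebraMap_eq fun c => (ψ.commutes c).symm
  have : IsLocalization.Away r B := IsLocalization.Away.mk r hunit hsurj
    fun a b h => ⟨0, by rw [hinj h]⟩
  exact Algebra.Smooth.of_equiv
    ((IsLocalization.algEquiv (Submonoid.powers r) B (Localization.Away r)).restrictScalars k)

theorem sum_smul_add_nsmul_linearCombination {ι L : Type*} [Fintype ι] [AddCommGroup L] (δ : ι → L)
    {a : ι → ℤ} {n : ℕ} (hn : ∀ j, 0 ≤ a j + n) :
    ∑ j, a j • δ j + n • Finsupp.linearCombination ℕ δ (Finsupp.equivFunOnFinite.symm 1) =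
      Finsupp.linearCombination ℕ δ (Finsupp.equivFunOnFinite.symm fun j => (a j + n).toNat) := by
  simp only [Finsupp.linearCombination_apply]
  rw [Finsupp.sum_fintype _ _ (by simp), Finsupp.sum_fintype _ _ (by simp), Finset.smul_sum,
    ← Finset.sum_add_distrib]
  refine Finset.sum_congr rfl fun j _ => ?_
  rw [Finsupp.equivFunOnFinite_symm_apply_apply, Finsupp.equivFunOnFinite_symm_apply_apply,
    ← natCast_zsmul _ (a j + n).toNat, Int.toNat_of_nonneg (hn j), add_smul, natCast_zsmul,
    Pi.one_apply, one_smul]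

theorem Finset.zpow_sum {ι G : Type*} [CommGroup G] (s : Finset ι) (f : ι → ℤ) (g : G) :
    g ^ (∑ i ∈ s, f i) = ∏ i ∈ s, g ^ f i := by
  classical
  induction s using Finset.induction_on with
  | empty => simp
  | insert i s hi ih => rw [Finset.sum_insert hi, Finset.prod_insert hi, zpow_add, ih]

section ToricClosure

open MvPolynomial ProjVar

variable {k : Type u} [Field k] {R ι : Type}

theorem ADisc.eval_pderiv_poly [Fintype ι] (A : ι → (R →₀ ℕ)) (a : ι → k) (x : R → k) (ρ : R) :
    eval x (pderiv ρ (ADisc.poly A a)) =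
      ∑ j, a j * eval x (pderiv ρ (monomial (A j) 1)) := by
  simp only [ADisc.poly, map_sum]
  refine Finset.sum_congr rfl fun j _ => ?_
  rw [← smul_eval, ← Derivation.map_smul, smul_monomial, smul_eq_mul, mul_one]

/-- `Z` is the closure of the image of the torus under the monomials with exponents `A`, in the
sense that it contains this image and satisfies all equations of the image. -/
structure IsToricClosure [Fintype R] [Nonempty ι] (A : ι → (R →₀ ℕ)) (Z : Set (ℙ k (ι → k))) :
    Prop where
  mem : ∀ x : R → kˣ, Projectivization.mk k (monomialVector A x) (monomialVector_ne_zero A x) ∈ Z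
  eval_eq_zero : ∀ (d : ℕ) (G : MvPolynomial ι k), G.IsHomogeneous d →
    (∀ x : R → kˣ, eval (monomialVector A x) G = 0) → ∀ p ∈ Z, eval p.rep G = 0

/-- The lattice spanned by the differences of the exponents with the exponent at `i`. -/
def differenceLattice (A : ι → (R →₀ ℕ)) (i : ι) : Submodule ℤ (R → ℤ) :=
  Submodule.span ℤ (Set.range fun j ρ => (A j ρ : ℤ) - A i ρ)

/-- A difference of exponents as an element of the lattice they span. -/
def exponentDifference (A : ι → (R →₀ ℕ)) (i j : ι) : differenceLattice A i :=
  ⟨fun ρ => (A j ρ : ℤ) - A i ρ, Submodule.subset_span ⟨j, rfl⟩⟩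

/-- The parametrization of the affine chart by the torus, on functions. -/
def chartParam (k : Type u) [Field k] (A : ι → (R →₀ ℕ)) (i : ι) :
    MvPolynomial ι k →ₐ[k] AddMonoidAlgebra k (differenceLattice A i) :=
  AddMonoidAlgebra.mapDomainAlgHom k k
    (Finsupp.linearCombination ℕ (exponentDifference A i)).toAddMonoidHom

theorem chartParam_monomial (A : ι → (R →₀ ℕ)) (i : ι) (m : ι →₀ ℕ) (c : k) :
    chartParam k A i (monomial m c) =
      AddMonoidAlgebra.single (Finsupp.linearCombination ℕ (exponentDifference A i) m) c := by
  change AddMonoidAlgebra.mapDomain _ (AddMonoidAlgebra.single m c) = _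
  rw [AddMonoidAlgebra.mapDomain_single]
  rfl

/-- Exponents in the lattice are integer combinations of the differences; a high power of the
product of all coordinates (the all-ones exponent) makes the coefficients nonnegative. -/
theorem exists_mul_pow_eq_chartParam [Fintype ι] (A : ι → (R →₀ ℕ)) (i : ι)
    (b : AddMonoidAlgebra k (differenceLattice A i)) :
    ∃ (n : ℕ) (f : MvPolynomial ι k),
      b * chartParam k A i (monomial (Finsupp.equivFunOnFinite.symm 1) 1) ^ n =
        chartParam k A i f := by
  induction b using AddMonoidAlgebra.induction_linear with
  | zero => exact ⟨0, 0, by simp⟩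
  | add p q hp hq =>
    obtain ⟨n, f, hf⟩ := hp
    obtain ⟨m, g, hg⟩ := hq
    refine ⟨n + m, f * monomial (Finsupp.equivFunOnFinite.symm 1) 1 ^ m +
      g * monomial (Finsupp.equivFunOnFinite.symm 1) 1 ^ n, ?_⟩
    rw [map_add, map_mul, map_mul, map_pow, map_pow, ← hf, ← hg]
    ring
  | single l c =>
    obtain ⟨a, ha⟩ := (Submodule.mem_span_range_iff_exists_fun ℤ).1 l.2
    let n : ℕ := ∑ j, (a j).natAbs
    have hn : ∀ j, 0 ≤ a j + n := by
      intro j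
      have h1 : (a j).natAbs ≤ n :=
        Finset.single_le_sum (f := fun j => (a j).natAbs) (fun _ _ => Nat.zero_le _)
          (Finset.mem_univ j)
      omega
    refine ⟨n, monomial (Finsupp.equivFunOnFinite.symm fun j => (a j + n).toNat) c, ?_⟩
    rw [← map_pow, monomial_pow, chartParam_monomial, chartParam_monomial,
      AddMonoidAlgebra.single_mul_single, one_pow, mul_one]
    have hl : l = ∑ j, a j • exponentDifference A i j := by
      apply Subtype.ext
      rw [Submodule.coe_sum, ← ha]
      rfl
    rw [hl, map_nsmul, sum_smul_add_nsmul_linearCombination _ hn]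

variable [Fintype R]

theorem torusEval_chartParam (A : ι → (R →₀ ℕ)) (i : ι) (x : R → kˣ) (f : MvPolynomial ι k) :
    torusEval x (AddMonoidAlgebra.mapDomain (differenceLattice A i).subtype (chartParam k A i f)) =
      eval ((monomialVector A x i)⁻¹ • monomialVector A x) f := by
  have h : ((torusEval x).comp (AddMonoidAlgebra.mapDomainAlgHom k k
      (differenceLattice A i).subtype.toAddMonoidHom)).comp (chartParam k A i) =
      aeval ((monomialVector A x i)⁻¹ • monomialVector A x) := by
    refine MvPolynomial.algHom_ext fun j => ?_
    rw [aeval_X, AlgHom.comp_apply, AlgHom.comp_apply, X, chartParam_monomial,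
      AddMonoidAlgebra.mapDomainAlgHom_apply, AddMonoidAlgebra.mapDomain_single, torusEval_single,
      Finsupp.linearCombination_single, one_smul, one_mul]
    have := laurentMonomial_sub x (fun ρ => (A j ρ : ℤ)) fun ρ => (A i ρ : ℤ)
    simp only [Pi.smul_apply, smul_eq_mul, monomialVector]
    rw [mul_comm, ← Units.val_inv_eq_inv_val, ← Units.val_mul, ← this]
    rfl
  exact DFunLike.congr_fun h f

theorem chartParam_eq_zero_iff [CharZero k] (A : ι → (R →₀ ℕ)) (i : ι) (f : MvPolynomial ι k) :
    chartParam k A i f = 0 ↔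
      ∀ x : R → kˣ, eval ((monomialVector A x i)⁻¹ • monomialVector A x) f = 0 := by
  constructor
  · intro h x
    rw [← torusEval_chartParam, h, AddMonoidAlgebra.mapDomain_zero, map_zero]
  · intro h
    refine AddMonoidAlgebra.mapDomain_injective
      (f := (differenceLattice A i).subtype) Subtype.val_injective ?_
    rw [AddMonoidAlgebra.mapDomain_zero]
    exact eq_zero_of_torusEval fun x => by rw [torusEval_chartParam, h]

/-- The rescaled torus points lie in the chart. Conversely, a polynomial vanishing at them
homogenizes to a form that vanishes on the torus image, hence on all of `Z`. -/
theorem IsToricClosure.vanishingIdeal_affineChart [Nonempty ι] [CharZero k]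
    {A : ι → (R →₀ ℕ)} {Z : Set (ℙ k (ι → k))} (hZ : IsToricClosure A Z) (i : ι) :
    vanishingIdeal k (affineChart Z i) = RingHom.ker (chartParam k A i) := by
  ext f
  rw [mem_vanishingIdeal_iff, RingHom.mem_ker, chartParam_eq_zero_iff]
  constructor
  · intro h x
    have hi := monomialVector_apply_ne_zero A x i
    have hv : (monomialVector A x i)⁻¹ • monomialVector A x ≠ 0 :=
      smul_ne_zero (inv_ne_zero hi) (monomialVector_ne_zero A x)
    refine h _ ⟨by simp [hi], hv, ?_⟩
    convert hZ.mem x using 1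
    exact (Projectivization.mk_eq_mk_iff' k _ _ _ _).2 ⟨_, rfl⟩
  · rintro h v ⟨hvi, hv, hvZ⟩
    have hF := homogenizeAt_isHomogeneous i f
    have h1 := hZ.eval_eq_zero _ _ hF (fun x => by
      have hi := monomialVector_apply_ne_zero A x i
      have h2 := hF.eval_smul (monomialVector A x i)⁻¹ (monomialVector A x)
      rw [eval_homogenizeAt _ (by simp [hi]), h x] at h2
      exact (mul_eq_zero.1 h2.symm).resolve_left (pow_ne_zero _ (inv_ne_zero hi))) _ hvZ
    rw [eval_rep_mk_eq_zero_iff hF, eval_homogenizeAt _ hvi] at h1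
    exact h1

/-- The points of the torus are smooth. -/
theorem IsToricClosure.isSmoothPoint [Nonempty ι] [Fintype ι] [CharZero k]
    {A : ι → (R →₀ ℕ)} {Z : Set (ℙ k (ι → k))} (hZ : IsToricClosure A Z) (x : R → kˣ) :
    IsSmoothPoint Z
      (Projectivization.mk k (monomialVector A x) (monomialVector_ne_zero A x)) := by
  refine ⟨hZ.mem x, ?_⟩
  obtain ⟨c, hc, hrep⟩ := rep_mk (monomialVector A x) (monomialVector_ne_zero A x)
  have hne : ∀ j, (c • monomialVector A x) j ≠ 0 := fun j =>
    mul_ne_zero hc (monomialVector_apply_ne_zero A x j)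
  let i : ι := Classical.arbitrary ι
  rw [hrep]
  -- The principal open set is where all coordinates are nonzero; its ring is the group algebra of
  -- the difference lattice.
  refine ⟨i, hne i, monomial (Finsupp.equivFunOnFinite.symm 1) 1, ?_, ?_⟩
  · rw [eval_monomial, one_mul]
    exact Finsupp.prod_ne_zero_iff.2 fun j _ =>
      pow_ne_zero _ (mul_ne_zero (inv_ne_zero (hne i)) (hne j))
  · have := AddMonoidAlgebra.smooth_of_lattice k (differenceLattice A i)
    have hker := hZ.vanishingIdeal_affineChart i
    let ψ := Ideal.Quotient.liftₐ (vanishingIdeal k (affineChart Z i)) (chartParam k A i)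
      fun a ha => by rwa [hker] at ha
    have hψ : ∀ f, ψ (Ideal.Quotient.mk _ f) = chartParam k A i f := fun f => rfl
    refine Algebra.smooth_localizationAway ψ _ ?_ ?_ ?_
    · rw [injective_iff_map_eq_zero]
      intro a ha
      obtain ⟨f, rfl⟩ := Ideal.Quotient.mk_surjective a
      rw [hψ] at ha
      rw [Ideal.Quotient.eq_zero_iff_mem, hker]
      exact ha
    · rw [hψ, chartParam_monomial]
      refine IsUnit.of_mul_eq_one (AddMonoidAlgebra.single (-Finsupp.linearCombination ℕ
        (exponentDifference A i) (Finsupp.equivFunOnFinite.symm 1)) 1) ?_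
      · rw [AddMonoidAlgebra.single_mul_single, add_neg_cancel, mul_one]
        rfl
    · intro b
      obtain ⟨n, f, hf⟩ := exists_mul_pow_eq_chartParam A i b
      exact ⟨n, Ideal.Quotient.mk _ f, by rw [hψ, hψ, hf]⟩

/-! ## The discriminant of a projective toric variety is its dual -/

theorem ADisc.eval_poly [Fintype ι] (A : ι → (R →₀ ℕ)) (a : ι → k) (x : R → kˣ) :
    eval (fun ρ => (x ρ : k)) (ADisc.poly A a) = ∑ j, a j * monomialVector A x j := by
  simp only [ADisc.poly, map_sum, eval_monomial_units]

/-- The operator x_ρ ∂_ρ multiplies a monomial by its exponent, so being singular at x is a linear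
system in the numbers a_j x^(ω_j), with integer coefficients. -/
theorem ADisc.unit_mul_eval_pderiv_poly [Fintype ι] (A : ι → (R →₀ ℕ)) (a : ι → k)
    (x : R → kˣ) (ρ : R) :
    x ρ * eval (fun ρ => (x ρ : k)) (pderiv ρ (ADisc.poly A a)) =
      ∑ j, (A j ρ : k) * (a j * monomialVector A x j) := by
  have h : ∀ p : MvPolynomial R k, x ρ * eval (fun ρ => (x ρ : k)) p =
      eval (fun ρ => (x ρ : k)) (X ρ * p) := fun p => by simp
  rw [h]
  simp only [ADisc.poly, map_sum, Finset.mul_sum]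
  refine Finset.sum_congr rfl fun j _ => ?_
  rw [X_mul_pderiv_monomial, map_nsmul, eval_monomial_units, nsmul_eq_mul]

variable [Nonempty ι] [Fintype ι] {A : ι → (R →₀ ℕ)} {Z : Set (ℙ k (ι → k))}

/-- The value at x vanishes by Euler's identity for F, the partial derivatives by differentiating
F(t(x)) = 0. -/
theorem IsToricClosure.gradient_mem_openLocus [Infinite k] (hZ : IsToricClosure A Z)
    {d : ℕ} {F : MvPolynomial ι k} (hF : F.IsHomogeneous d) (hFZ : ∀ p ∈ Z, eval p.rep F = 0)
    (x : R → kˣ) (hb : (fun j => eval (monomialVector A x) (pderiv j F)) ≠ 0) :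
    Projectivization.mk k _ hb ∈ ADisc.openLocus k A := by
  have hvan : ∀ x : R → kˣ, eval (monomialVector A x) F = 0 := fun x =>
    (eval_rep_mk_eq_zero_iff hF _ _).1 (hFZ _ (hZ.mem x))
  obtain ⟨c, hc, hrep⟩ := rep_mk _ hb
  refine ⟨fun ρ => x ρ, fun ρ => (x ρ).ne_zero, ?_, fun ρ => ?_⟩
  · rw [ADisc.eval_poly, hrep]
    simp only [Pi.smul_apply, smul_eq_mul, mul_assoc, ← Finset.mul_sum]
    rw [hF.sum_mul_eval_pderiv, hvan, mul_zero, mul_zero]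
  · rw [ADisc.eval_pderiv_poly, hrep]
    simp only [Pi.smul_apply, smul_eq_mul, mul_assoc, ← Finset.mul_sum]
    rw [sum_pderiv_mul_pderiv_monomial A hvan, mul_zero]

theorem IsToricClosure.projectiveDual_subset [Infinite k] (hZ : IsToricClosure A Z) :
    projectiveDual Z ⊆ ADisc.locus k A := by
  refine closure_minimal ?_ isClosed_closure
  rintro a ⟨z, ⟨hzZ, -⟩, ha⟩
  obtain ⟨d, F, hF, hFZ, hgrad⟩ := exists_eq_gradient hzZ ha
  refine mem_closure_iff.2 fun e H hH hHa => ?_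
  obtain ⟨i, hi⟩ := Function.ne_iff.1 a.rep_nonzero
  have hev : ∀ v : ι → k, eval v (aeval (fun j => pderiv j F) H) =
      eval (fun j => eval v (pderiv j F)) H := fun v => by
    rw [← coe_aeval_eq_eval, ← coe_aeval_eq_eval]
    exact comp_aeval_apply (fun j => pderiv j F) (aeval v) H
  -- The first factor detects H ≠ 0 at the gradient; the second keeps the gradient nonzero, so that
  -- it defines a projective point.
  have hK : (aeval (fun j => pderiv j F) H * pderiv i F).IsHomogeneous ((d - 1) * e + (d - 1)) :=
    (hH.aeval _ fun j => hF.pderiv).mul hF.pderiv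
  have hx : ∃ x : R → kˣ, eval (monomialVector A x)
      (aeval (fun j => pderiv j F) H * pderiv i F) ≠ 0 := by
    by_contra! hcon
    have h0 := hZ.eval_eq_zero _ _ hK hcon z hzZ
    rw [map_mul, hev, ← hgrad] at h0
    rcases mul_eq_zero.1 h0 with h1 | h1
    · exact hHa h1
    · exact hi (by rw [hgrad]; exact h1)
  obtain ⟨x, hx⟩ := hx
  rw [map_mul, hev] at hx
  have hb : (fun j => eval (monomialVector A x) (pderiv j F)) ≠ 0 := fun h =>
    right_ne_zero_of_mul hx (congrFun h i)
  exact ⟨_, hZ.gradient_mem_openLocus hF hFZ x hb, fun h =>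
    left_ne_zero_of_mul hx ((eval_rep_mk_eq_zero_iff hH _ _).1 h)⟩

/-- Up to scaling its coordinates, a tangent vector at a point with nonzero coordinates satisfies
the affine relations between the exponents. -/
theorem IsToricClosure.sum_mul_div_eq_zero (hZ : IsToricClosure A Z)
    {z : ℙ k (ι → k)} (hz : z ∈ Z) (hne : ∀ j, z.rep j ≠ 0) {w : ι → k}
    (hw : w ∈ embeddedTangentSpace Z z) {c : ι → ℤ} (hc : ∑ j, c j = 0)
    (hcA : ∀ ρ, ∑ j, (A j ρ : ℤ) * c j = 0) : ∑ j, (c j : k) * (w j / z.rep j) = 0 := by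
  -- Here β - β' = c. The binomial w^β - w^β' is homogeneous because ∑ c_j = 0 and vanishes on `Z`
  -- because Ac = 0.
  let β : ι →₀ ℕ := Finsupp.equivFunOnFinite.symm fun j => (c j).toNat
  let β' : ι →₀ ℕ := Finsupp.equivFunOnFinite.symm fun j => (-c j).toNat
  have hsub : ∀ j, (β j : ℤ) - β' j = c j := fun j => Int.toNat_sub_toNat_neg (c j)
  have hdeg : β'.degree = β.degree := by
    have : (∑ j, (β j : ℤ)) - ∑ j, (β' j : ℤ) = 0 := by
      rw [← Finset.sum_sub_distrib, ← hc]
      exact Finset.sum_congr rfl fun j _ => hsub j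
    rw [Finsupp.degree_eq_sum, Finsupp.degree_eq_sum]
    zify
    linarith
  have hF : (monomial β (1 : k) - monomial β' 1).IsHomogeneous β.degree :=
    (isHomogeneous_monomial 1 rfl).sub (isHomogeneous_monomial 1 hdeg)
  have hmon : ∀ (x : R → kˣ) (γ : ι →₀ ℕ), eval (monomialVector A x) (monomial γ (1 : k)) =
      laurentMonomial x (fun ρ => ∑ j, (A j ρ : ℤ) * γ j) := by
    intro x γ
    rw [eval_monomial, one_mul, Finsupp.prod_fintype _ _ (by simp)]
    simp only [monomialVector, laurentMonomial, Units.coe_prod, ← Finset.prod_pow]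
    rw [Finset.prod_comm]
    refine Finset.prod_congr rfl fun ρ _ => ?_
    rw [Finset.zpow_sum, Units.coe_prod]
    simp [zpow_mul]
  have hFZ : ∀ p ∈ Z, eval p.rep (monomial β (1 : k) - monomial β' 1) = 0 := by
    refine hZ.eval_eq_zero _ _ hF fun x => ?_
    rw [map_sub, hmon, hmon, sub_eq_zero]
    congr 2
    ext ρ
    rw [← sub_eq_zero, ← Finset.sum_sub_distrib, ← hcA ρ]
    exact Finset.sum_congr rfl fun j _ => by rw [← mul_sub, hsub]
  have htan := hw _ _ hF hFZ
  have hz0 := hFZ z hz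
  rw [map_sub, sub_eq_zero] at hz0
  have hpd : ∀ (γ : ι →₀ ℕ) (j : ι), eval z.rep (pderiv j (monomial γ (1 : k))) * w j =
      eval z.rep (monomial γ (1 : k)) * (γ j * (w j / z.rep j)) := by
    intro γ j
    have h1 := congrArg (eval z.rep) (X_mul_pderiv_monomial (R := k) (i := j) (m := γ) (r := 1))
    rw [map_mul, eval_X, map_nsmul, nsmul_eq_mul] at h1
    have h2 := hne j
    field_simp
    linear_combination w j * h1
  simp only [map_sub, sub_mul, hpd, Finset.sum_sub_distrib, ← Finset.mul_sum] at htan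
  rw [← hz0, ← mul_sub, ← Finset.sum_sub_distrib] at htan
  have hmne : eval z.rep (monomial β (1 : k)) ≠ 0 := by
    rw [eval_monomial, one_mul]
    exact Finsupp.prod_ne_zero_iff.2 fun j _ => pow_ne_zero _ (hne j)
  rw [← (mul_eq_zero.1 htan).resolve_left hmne]
  refine Finset.sum_congr rfl fun j _ => ?_
  rw [← hsub j]
  push_cast
  ring

theorem IsToricClosure.openLocus_subset [CharZero k] (hZ : IsToricClosure A Z) :
    ADisc.openLocus k A ⊆
      {a | ∃ z, IsSmoothPoint Z z ∧ ∀ w ∈ embeddedTangentSpace Z z, ∑ j, a.rep j * w j = 0} := by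
  rintro a ⟨x, hx0, hfx, hdfx⟩
  obtain ⟨x, rfl⟩ : ∃ y : R → kˣ, x = fun ρ => (y ρ : k) :=
    ⟨fun ρ => Units.mk0 (x ρ) (hx0 ρ), rfl⟩
  refine ⟨_, hZ.isSmoothPoint x, fun w hw => ?_⟩
  obtain ⟨c, hc, hrep⟩ := rep_mk (monomialVector A x) (monomialVector_ne_zero A x)
  have hne : ∀ j, (Projectivization.mk k _ (monomialVector_ne_zero A x)).rep j ≠ 0 := fun j => by
    rw [hrep]
    exact mul_ne_zero hc (monomialVector_apply_ne_zero A x j)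
  -- The row of ones (`none`) encodes f(x) = 0, the rows of A the equations x_ρ ∂_ρ f(x) = 0.
  have key := sum_mul_eq_zero_of_int_solutions
    (fun (o : Option R) j => o.elim (1 : ℤ) fun ρ => (A j ρ : ℤ))
    (fun j => w j / (Projectivization.mk k _ (monomialVector_ne_zero A x)).rep j)
    (fun b hb => hZ.sum_mul_div_eq_zero (hZ.mem x) hne hw
      (by simpa using hb none) fun ρ => hb (some ρ))
    (fun j => a.rep j * monomialVector A x j) (by
      rintro (_ | ρ)
      · rw [ADisc.eval_poly] at hfx
        simpa using hfx
      · have := ADisc.unit_mul_eval_pderiv_poly A a.rep x ρ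
        rw [hdfx ρ, mul_zero] at this
        simpa using this.symm)
  have hsum : ∑ j, a.rep j * w j = c * ∑ j, a.rep j * monomialVector A x j *
      (w j / (Projectivization.mk k _ (monomialVector_ne_zero A x)).rep j) := by
    rw [Finset.mul_sum]
    refine Finset.sum_congr rfl fun j _ => ?_
    have h1 := monomialVector_apply_ne_zero A x j
    rw [hrep, Pi.smul_apply, smul_eq_mul]
    field_simp
  rw [hsum, key, mul_zero]

theorem IsToricClosure.locus_eq_projectiveDual [CharZero k] (hZ : IsToricClosure A Z) :
    ADisc.locus k A = projectiveDual Z :=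
  (closure_mono hZ.openLocus_subset).antisymm hZ.projectiveDual_subset

end ToricClosure

/-! ## The image of a toric variety under a complete linear system -/

namespace Toric

open MvPolynomial

variable {k : Type u} [Field k] {n : ℕ} {F : Fan n}

/-- A point of a chart as an algebra homomorphism. -/
def ChartPoint.toAlgHom {σ : PointedCone ℝ (Fin n → ℝ)} (γ : ChartPoint k σ) :
    chartRing k σ →ₐ[k] k := γ

namespace Fan

/-- The inclusion of `k[S_σ]` into the Laurent polynomials in the Cox variables. -/
def coxMap (F : Fan n) (k : Type u) [Field k] (σ : PointedCone ℝ (Fin n → ℝ)) :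
    chartRing k σ →ₐ[k] AddMonoidAlgebra k (F.Ray → ℤ) :=
  AddMonoidAlgebra.mapDomainAlgHom k k (F.divChar.comp (dualMonoid σ).subtype)

theorem coxMap_chartChar {σ : PointedCone ℝ (Fin n → ℝ)} (m : dualMonoid σ) :
    F.coxMap k σ (chartChar k m) = AddMonoidAlgebra.single (F.divChar m) 1 := by
  rw [coxMap, chartChar, AddMonoidAlgebra.mapDomainAlgHom_apply, AddMonoidAlgebra.mapDomain_single]
  rfl

theorem IsComplete.coxMap_injective (hF : F.IsComplete) (σ : PointedCone ℝ (Fin n → ℝ)) :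
    Function.Injective (F.coxMap k σ) :=
  AddMonoidAlgebra.mapDomain_injective (hF.divChar_injective.comp Subtype.val_injective)

variable {ι : Type} {α : F.ClassGroup} {e : ι ≃ F.Monomials α} [Fintype F.Ray]

/-- The factor x^(-D) does not depend on j, so the local and the Cox descriptions of φ give the same
projective point. -/
theorem laurentMonomial_divChar {D : F.Ray → ℤ} {m : Fin n → ℤ} {j : ι}
    (h : (fun ρ => ((e j).1 ρ : ℤ)) = D + F.divChar m) (x : F.Ray → kˣ) :
    (laurentMonomial x (F.divChar m) : k) =
      ((laurentMonomial x D)⁻¹ : kˣ) * monomialVector (F.exponentMatrix e) x j := by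
  have : (fun ρ => (F.exponentMatrix e j ρ : ℤ)) = D + F.divChar m := h
  rw [monomialVector, this, laurentMonomial_add, Units.val_mul, Units.inv_mul_cancel_left]

/-- The pullback of G to k[S_σ] is zero already as a Laurent polynomial, so it vanishes at every
point of the chart, also off the torus. -/
theorem IsComplete.eval_chart_eq_zero [CharZero k] (hF : F.IsComplete)
    {σ : PointedCone ℝ (Fin n → ℝ)} (γ : ChartPoint k σ) {D : F.Ray → ℤ} {l : ι → dualMonoid σ}
    (hl : ∀ j, (fun ρ => ((e j).1 ρ : ℤ)) = D + F.divChar (l j : Fin n → ℤ))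
    {d : ℕ} {G : MvPolynomial ι k} (hG : G.IsHomogeneous d)
    (h : ∀ x : F.Ray → kˣ, eval (monomialVector (F.exponentMatrix e) x) G = 0) :
    eval (fun j => γ.eval (chartChar k (l j))) G = 0 := by
  have h0 : aeval (fun j => chartChar k (l j)) G = 0 := by
    refine hF.coxMap_injective (k := k) σ ?_
    rw [map_zero]
    refine eq_zero_of_torusEval fun x => ?_
    rw [comp_aeval_apply, comp_aeval_apply]
    simp only [coxMap_chartChar, torusEval_single, one_mul, laurentMonomial_divChar (hl _)]
    have := hG.aeval_smul ((laurentMonomial x D)⁻¹ : kˣ).1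
      (monomialVector (F.exponentMatrix e) x)
    have hx : aeval (monomialVector (F.exponentMatrix e) x) G = 0 := h x
    rw [this, hx, mul_zero]
  have h1 := comp_aeval_apply (fun j => chartChar k (l j)) γ.toAlgHom G
  rw [h0, map_zero] at h1
  exact h1.symm

theorem IsMapOfClass.isToricClosure [CharZero k] [Nonempty ι] (hF : F.IsComplete)
    {φ : F.Variety k → ℙ k (ι → k)} (hφ : IsMapOfClass e φ) :
    IsToricClosure (F.exponentMatrix e) (Set.range φ) where
  mem x := by
    -- The Cox torus point x acts on characters through χ^m ↦ x^(div χ^m), which defines a point of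
    -- the chart of the zero cone.
    let γ : ChartPoint k (⊥ : PointedCone ℝ (Fin n → ℝ)) := (torusEval x).comp (F.coxMap k ⊥)
    obtain ⟨D, -, -, l, hl, hv, hpt⟩ := hφ ⊥ F.bot_mem_cones γ
    refine ⟨_, hpt.trans ((Projectivization.mk_eq_mk_iff' k _ _ _ _).2
      ⟨((laurentMonomial x D)⁻¹ : kˣ), ?_⟩)⟩
    ext j
    have : γ.eval (chartChar k (l j)) = torusEval x (F.coxMap k ⊥ (chartChar k (l j))) := rfl
    rw [this, coxMap_chartChar, torusEval_single, one_mul, laurentMonomial_divChar (hl j)]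
    rfl
  eval_eq_zero := by
    rintro d G hG h _ ⟨p, rfl⟩
    obtain ⟨⟨⟨σ, hσ⟩, γ⟩, rfl⟩ := Quot.exists_rep p
    obtain ⟨D, -, -, l, hl, hv, hpt⟩ := hφ σ hσ γ
    have hpt' : φ (Quot.mk _ ⟨⟨σ, hσ⟩, γ⟩) = _ := hpt
    rw [hpt', ProjVar.eval_rep_mk_eq_zero_iff hG]
    exact hF.eval_chart_eq_zero γ hl hG h

end Fan

end Toric

end

theorem mainTheorem8 {k : Type u} [Field k] [IsAlgClosed k] [CharZero k]
    {n : ℕ} (F : Toric.Fan n) (hF : F.IsComplete)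
    (α : F.ClassGroup) (hα : Toric.Fan.IsVeryAmple k α)
    {N : ℕ} (e : Fin (N + 1) ≃ F.Monomials α)
    (φ : F.Variety k → ℙ k (Fin (N + 1) → k)) (hφ : Toric.Fan.IsMapOfClass e φ) :
    ADisc.locus k (F.exponentMatrix e) = ProjVar.projectiveDual (Set.range φ) := by
  have := Fintype.ofFinite F.Ray
  exact (hφ.isToricClosure hF).locus_eq_projectiveDual
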